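/- Let $M\in\mathbb R^{n\times m}$ with $n\ge m$, let $1\le r\le m$, and let $M=\sum_{i=1}^m\sigma_i u_iv_i^\top$ be a singular value decomposition with $\sigma_1\ge\dots\ge\sigma_m\ge 0$ and orthonormal families $(u_i)_i$, $(v_i)_i$. Put $U_1=(u_1,\dots,u_r)$, $V_1=(v_1,\dots,v_r)$, and define the incoherence $$\mu(r)=\max\Bigl(\max_{i\le n}\tfrac nr|(U_1)_{i,*}|^2,\ \max_{j\le m}\tfrac mr|(V_1)_{j,*}|^2\Bigr).$$ Sample, independently and each uniformly at random without replacement, $d\le m$ columns of $M$ (forming $A\in\mathbb R^{n\times d}$), $d$ rows of $M$ (forming, transposed, $B\in\mathbb R^{m\times d}$), and a set $\Omega$ of $|\Omega|\le nm$ index pairs, where $d$ and $|\Omega|$ are fixed numbers. A CUR+ estimate of $M$ is a matrix $\widehat M=\widehat UZ_*\widehat V^\top$, where the columns of $\widehat U$ and $\widehat V$ are orthonormal eigenvectors belonging to the $r$ largest eigenvalues (with multiplicity) of $AA^\top$ and $BB^\top$, respectively, and $Z_*\in\mathbb R^{r\times r}$ is a minimizer of $$\tfrac12\sum_{(i,j)\in\Omega}\bigl(M_{ij}-(\widehat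 UZ\widehat V^\top)_{ij}\bigr)^2 .$$ If $\operatorname{rank}(M)<r$, the singular vectors and eigenvectors belonging to the value $0$ are not determined, and it is understood that these ties are broken consistently: $\widehat U$ has the same column space as $U_1$ whenever $A$ has the same column space as $M$, and $\widehat V$ has the same column space as $V_1$ whenever $B$ has the same column space as $M^\top$. Nothing is required of the choices if $\operatorname{rank}(M)=r$. (a) Let $t\in\mathbb R$. If $\operatorname{rank}(M)\le r$, $d\ge 7\mu(r)\,r\,(t+\ln r)$ and $|\Omega|\ge 7\mu(r)^2r^2(t+2\ln r)$, then with probability at least $1-5e^{-t}$ the only CUR+ estimate, whatever the admissible choices of $\widehat U$, $\widehat V$ and $Z_*$, is $\widehat M=M$. (b) Consequently, for all constants $c>0$ and $\mu_0$ there is a constant $C>0$, depending only on $c$ and $\mu_0$, such that for all integers $2\le r\le n$ there are numbers $d\le n$ and $|\Omega|\le n^2$ with $2dn+|\Omega|\le C\,n\,r\ln r$, for which every $n\times n$ matrix $M$ of rank $r$ with $\mu(r)\le\mu_0$ is recovered exactly, in the sense of (a), with probability at least $1-5e^{-t}$, where $t=c\ln r$. -/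

import Mathlib

open scoped Matrix

noncomputable section

namespace CURPlus

/-- The first `r` columns of a matrix. -/
def firstCols {k l r : ℕ} (h : r ≤ l) (X : Matrix (Fin k) (Fin l) ℝ) :
    Matrix (Fin k) (Fin r) ℝ :=
  X.submatrix id (Fin.castLE h)

/-- `M = U Σ Vᵀ` is a singular value decomposition of the `n × m` matrix `M` (`m ≤ n`), with the
singular values `σ` in descending order, and the left and right singular vectors as the columns of
`U` and `V`. -/
def IsSVD {n m : ℕ} (M : Matrix (Fin n) (Fin m) ℝ) (U : Matrix (Fin n) (Fin m) ℝ)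
    (σ : Fin m → ℝ) (V : Matrix (Fin m) (Fin m) ℝ) : Prop :=
  Uᵀ * U = 1 ∧ Vᵀ * V = 1 ∧ Antitone σ ∧ (∀ i, 0 ≤ σ i) ∧ M = U * Matrix.diagonal σ * Vᵀ

/-- The incoherence
`max (max_i (n / r) |i-th row of U₁|²) (max_i (m / r) |i-th row of V₁|²)`. -/
def incoherence {n m r : ℕ} (U₁ : Matrix (Fin n) (Fin r) ℝ) (V₁ : Matrix (Fin m) (Fin r) ℝ) : ℝ :=
  max (⨆ i : Fin n, (n : ℝ) / (r : ℝ) * ∑ k, U₁ i k ^ 2)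
    (⨆ i : Fin m, (m : ℝ) / (r : ℝ) * ∑ k, V₁ i k ^ 2)

/-- The columns of `E` are first `r` eigenvectors of the symmetric matrix `S`: they are the first
`r` members of an orthonormal basis of eigenvectors (the columns of `Q`) whose eigenvalues `ev` are
in descending order. -/
def IsFirstEigenvectors {k r : ℕ} (h : r ≤ k) (S : Matrix (Fin k) (Fin k) ℝ)
    (E : Matrix (Fin k) (Fin r) ℝ) : Prop :=
  ∃ (Q : Matrix (Fin k) (Fin k) ℝ) (ev : Fin k → ℝ),
    Qᵀ * Q = 1 ∧ Antitone ev ∧ S = Q * Matrix.diagonal ev * Qᵀ ∧ E = firstCols h Q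

/-- The column space of a matrix. -/
def colSpace {k l : ℕ} (X : Matrix (Fin k) (Fin l) ℝ) : Submodule ℝ (Fin k → ℝ) :=
  LinearMap.range X.mulVecLin

/-- The operator keeping the entries with index in `Ω` and setting all other entries to zero. -/
def restrictTo {n m : ℕ} (Ω : Finset (Fin n × Fin m)) (X : Matrix (Fin n) (Fin m) ℝ) :
    Matrix (Fin n) (Fin m) ℝ :=
  Matrix.of fun i j => if (i, j) ∈ Ω then X i j else 0

/-- The regression objective `(1/2) ‖R_Ω(M) - R_Ω(Û Z V̂ᵀ)‖_F²`. -/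
def objective {n m r : ℕ} (M : Matrix (Fin n) (Fin m) ℝ) (Uh : Matrix (Fin n) (Fin r) ℝ)
    (Vh : Matrix (Fin m) (Fin r) ℝ) (Ω : Finset (Fin n × Fin m))
    (Z : Matrix (Fin r) (Fin r) ℝ) : ℝ :=
  1 / 2 * ∑ i, ∑ j, (restrictTo Ω M - restrictTo Ω (Uh * Z * Vhᵀ)) i j ^ 2

/-- The matrix `A` whose columns are the sampled columns of `M`. -/
def sampledCols {n m d : ℕ} (M : Matrix (Fin n) (Fin m) ℝ) (I : Fin d ↪ Fin m) :
    Matrix (Fin n) (Fin d) ℝ :=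
  M.submatrix id I

/-- The matrix `B` whose columns are the (transposed) sampled rows of `M`. -/
def sampledRows {n m d : ℕ} (M : Matrix (Fin n) (Fin m) ℝ) (J : Fin d ↪ Fin n) :
    Matrix (Fin m) (Fin d) ℝ :=
  (M.submatrix J id)ᵀ

/-- `X` is a CUR+ estimate of `M` of target rank `r`, from the columns `I`, the rows `J` and the
entries `Ω`: `X = Û Z V̂ᵀ`, where `Û` and `V̂` consist of first `r` eigenvectors of `A Aᵀ` and
`B Bᵀ`, and `Z` is any minimizer of the regression objective.

Every choice of eigenvectors and of minimizer is allowed, with one convention. If `rank M < r`,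
then neither the singular vectors `U₁`, `V₁` that enter the incoherence nor `Û`, `V̂` have a
determined span, since some of them belong to the value zero. These ties are broken consistently:
`Û` spans the same space as `U₁` in case `A` has the same column space as `M`, and likewise for
`V̂`, `V₁`, `B`, `Mᵀ`. The matrices `U₁`, `V₁` play no role if `rank M = r`. -/
def IsEstimate {n m r d : ℕ} (hn : r ≤ n) (hm : r ≤ m) (M : Matrix (Fin n) (Fin m) ℝ)
    (U₁ : Matrix (Fin n) (Fin r) ℝ) (V₁ : Matrix (Fin m) (Fin r) ℝ)
    (I : Fin d ↪ Fin m) (J : Fin d ↪ Fin n) (Ω : Finset (Fin n × Fin m))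
    (X : Matrix (Fin n) (Fin m) ℝ) : Prop :=
  ∃ (Uh : Matrix (Fin n) (Fin r) ℝ) (Vh : Matrix (Fin m) (Fin r) ℝ)
    (Z : Matrix (Fin r) (Fin r) ℝ),
    IsFirstEigenvectors hn (sampledCols M I * (sampledCols M I)ᵀ) Uh ∧
    IsFirstEigenvectors hm (sampledRows M J * (sampledRows M J)ᵀ) Vh ∧
    (M.rank < r →
      (colSpace (sampledCols M I) = colSpace M → colSpace Uh = colSpace U₁) ∧
      (colSpace (sampledRows M J) = colSpace Mᵀ → colSpace Vh = colSpace V₁)) ∧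
    (∀ Z' : Matrix (Fin r) (Fin r) ℝ, objective M Uh Vh Ω Z ≤ objective M Uh Vh Ω Z') ∧
    X = Uh * Z * Vhᵀ

/-- The outcomes of the sampling: `d` distinct columns, `d` distinct rows, and a set of `s`
entries. -/
abbrev Sample (n m d s : ℕ) : Type :=
  (Fin d ↪ Fin m) × (Fin d ↪ Fin n) × {Ω : Finset (Fin n × Fin m) // Ω.card = s}

/-- The probability that CUR+ recovers `M` exactly, i.e. that `M` is the one and only CUR+ estimate,
when the columns, the rows and the entries are sampled independently, each uniformly at random
without replacement (so that the outcome is uniformly distributed on `Sample n m d s`). -/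
def recoveryProb {n m r : ℕ} (hn : r ≤ n) (hm : r ≤ m) (d s : ℕ) (M : Matrix (Fin n) (Fin m) ℝ)
    (U₁ : Matrix (Fin n) (Fin r) ℝ) (V₁ : Matrix (Fin m) (Fin r) ℝ) : ℝ :=
  (Nat.card {ω : Sample n m d s //
      {X | IsEstimate hn hm M U₁ V₁ ω.1 ω.2.1 ω.2.2.1 X} = {M}} : ℝ) /
    (Nat.card (Sample n m d s) : ℝ)

end CURPlus

end

/-! Write `M = X * D * Yᵀ`, with `X` and `Y` the first `r` left and right singular vectors. Recovery
is forced as soon as three samples determine vectors: the sampled rows of `Y` and of `X` must each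
have trivial common kernel in `ℝ^r`, and the rows of `X ⊗ₖ Y` indexed by `Ω` must have trivial
common kernel in `ℝ^(r × r)`. The first two conditions make the sampled columns and rows span the
column and row spaces of `M`, so `Û` and `V̂` span the same spaces as `X` and `Y`. Then the
regression attains the value zero, and the third condition says that a matrix `X * Z * Yᵀ` is fixed
by its entries in `Ω`. This is `setOf_isEstimate_eq_singleton`.

All three events are instances of one sampling problem: draw rows without replacement from `W` with
`Wᵀ * W = 1` and `N` rows of squared norm at most `ν / N`. No matrix concentration is used; the
potential is the codimension of the span of the rows drawn so far. By double counting, at least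
`codim * N / ν` rows lie outside this span, all of them still undrawn, and drawing one lowers the
codimension by one. The expected codimension thus shrinks by `1 - 1 / ν` per draw
(`sum_rowCodim_insert_le`). Since it is an integer, Markov's inequality bounds the failure
probability by `|κ| * exp (-d / ν)` (`card_not_determines_le`).

For columns and rows `ν = μ r` and `|κ| = r`; for entries `ν = μ² r²` and `|κ| = r²`. The union
bound gives failure probability at most `3 * exp (-t)`. For the second claim, sample sizes are
capped at their maxima, and an exhaustive sample determines everything with certainty. -/

namespace CURPlus

/-! ### Random rows of a Parseval frame -/

section RowSampling

variable {α κ : Type*} [Fintype κ]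

/-- The rows of `W` with index in `S` determine a vector through its products with them. -/
def Determines (W : Matrix α κ ℝ) (S : Set α) : Prop :=
  ∀ x : κ → ℝ, (∀ i ∈ S, W i ⬝ᵥ x = 0) → x = 0

/-- A row of a matrix as a vector of a Euclidean space. -/
def rowVec (W : Matrix α κ ℝ) (i : α) : EuclideanSpace ℝ κ := WithLp.toLp 2 (W i)

/-- The span of the rows with index in `S`. -/
def rowSpan (W : Matrix α κ ℝ) (S : Set α) : Submodule ℝ (EuclideanSpace ℝ κ) :=
  Submodule.span ℝ (rowVec W '' S)

/-- The codimension of the span of the rows with index in `S`. -/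
noncomputable def rowCodim (W : Matrix α κ ℝ) (S : Set α) : ℕ := Module.finrank ℝ (rowSpan W S)ᗮ

theorem inner_rowVec (W : Matrix α κ ℝ) (i : α) (x : EuclideanSpace ℝ κ) :
    inner ℝ x (rowVec W i) = W i ⬝ᵥ x.ofLp := by
  rw [EuclideanSpace.inner_eq_star_dotProduct]
  simp [rowVec]

theorem norm_rowVec_sq (W : Matrix α κ ℝ) (i : α) : ‖rowVec W i‖ ^ 2 = ∑ k, W i k ^ 2 := by
  rw [EuclideanSpace.real_norm_sq_eq]
  rfl

theorem determines_of_rowCodim_eq_zero {W : Matrix α κ ℝ} {S : Set α} (h : rowCodim W S = 0) :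
    Determines W S := by
  intro x hx
  have hbot : (rowSpan W S)ᗮ = ⊥ := Submodule.finrank_eq_zero.mp h
  have hmem : WithLp.toLp 2 x ∈ (rowSpan W S)ᗮ := by
    rw [Submodule.mem_orthogonal']
    intro u hu
    induction hu using Submodule.span_induction with
    | mem u hu =>
      obtain ⟨i, hi, rfl⟩ := hu
      rw [inner_rowVec]
      exact hx i hi
    | zero => simp
    | add u v _ _ hu hv => rw [inner_add_right, hu, hv, add_zero]
    | smul a u _ hu => rw [inner_smul_right, hu, mul_zero]
  rw [hbot, Submodule.mem_bot] at hmem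
  simpa using congrArg WithLp.ofLp hmem

theorem dotProduct_mulVec_self [Fintype α] [DecidableEq κ] {W : Matrix α κ ℝ} (hW : Wᵀ * W = 1) (x : κ → ℝ) :
    ∑ i, (W i ⬝ᵥ x) ^ 2 = x ⬝ᵥ x := by
  have h : (W *ᵥ x) ⬝ᵥ (W *ᵥ x) = x ⬝ᵥ x := by
    rw [Matrix.dotProduct_mulVec, Matrix.vecMul_mulVec, hW, Matrix.vecMul_one]
  rw [← h]
  simp only [dotProduct, sq, Matrix.mulVec]

theorem determines_univ [Fintype α] [DecidableEq κ] {W : Matrix α κ ℝ} (hW : Wᵀ * W = 1) :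
    Determines W Set.univ := by
  intro x hx
  have h := dotProduct_mulVec_self hW x
  rw [Finset.sum_eq_zero fun i _ => by rw [hx i (Set.mem_univ i)]; norm_num] at h
  exact dotProduct_self_eq_zero.mp h.symm

/-- If the rows of `W` form a Parseval frame of vectors with squared norm at most `R`, then at
least `codim K / R` of them lie outside the subspace `K`. -/
theorem finrank_orthogonal_le [Fintype α] [DecidableEq κ] {W : Matrix α κ ℝ} (hW : Wᵀ * W = 1) {R : ℝ}
    (hR : ∀ i, ∑ k, W i k ^ 2 ≤ R) (K : Submodule ℝ (EuclideanSpace ℝ κ))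
    [DecidablePred fun i => rowVec W i ∉ K] :
    (Module.finrank ℝ Kᗮ : ℝ) ≤ R * (Finset.univ.filter fun i => rowVec W i ∉ K).card := by
  -- The squared inner products of this basis with the rows are summed in two orders: Parseval gives
  -- `1` per basis vector, Bessel gives at most `R` per row outside `K` and `0` per row inside.
  set b := stdOrthonormalBasis ℝ Kᗮ
  have hb : Orthonormal ℝ fun i => (b i : EuclideanSpace ℝ κ) :=
    b.orthonormal.comp_linearIsometry Kᗮ.subtypeₗᵢ
  have hone (j) : ∑ i, (inner ℝ (b j : EuclideanSpace ℝ κ) (rowVec W i)) ^ 2 = 1 := by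
    simp only [inner_rowVec]
    rw [dotProduct_mulVec_self hW]
    have := hb.1 j
    have h2 : ‖(b j : EuclideanSpace ℝ κ)‖ ^ 2 = 1 := by rw [this]; norm_num
    rw [← h2, EuclideanSpace.real_norm_sq_eq]
    simp only [dotProduct, sq]
  have hbound (i) : ∑ j, (inner ℝ (b j : EuclideanSpace ℝ κ) (rowVec W i)) ^ 2 ≤
      if rowVec W i ∉ K then R else 0 := by
    by_cases h : rowVec W i ∉ K
    · rw [if_pos h]
      have := hb.sum_inner_products_le (rowVec W i) (s := Finset.univ)
      rw [norm_rowVec_sq] at this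
      simp only [Real.norm_eq_abs, sq_abs] at this
      exact this.trans (hR i)
    · rw [if_neg h]
      refine (Finset.sum_eq_zero fun j _ => ?_).le
      rw [Submodule.inner_left_of_mem_orthogonal (not_not.mp h) (b j).2]
      norm_num
  calc (Module.finrank ℝ Kᗮ : ℝ)
      = ∑ j, ∑ i, (inner ℝ (b j : EuclideanSpace ℝ κ) (rowVec W i)) ^ 2 := by
        simp [hone]
    _ = ∑ i, ∑ j, (inner ℝ (b j : EuclideanSpace ℝ κ) (rowVec W i)) ^ 2 := Finset.sum_comm
    _ ≤ ∑ i, if rowVec W i ∉ K then R else 0 := Finset.sum_le_sum fun i _ => hbound i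
    _ = _ := by
        rw [← Finset.sum_filter, Finset.sum_const, nsmul_eq_mul, mul_comm]

theorem rowCodim_insert_le (W : Matrix α κ ℝ) (S : Set α) (i : α)
    [Decidable (rowVec W i ∉ rowSpan W S)] :
    (rowCodim W (insert i S) : ℝ) ≤
      rowCodim W S - if rowVec W i ∉ rowSpan W S then 1 else 0 := by
  have hle : rowSpan W S ≤ rowSpan W (insert i S) :=
    Submodule.span_mono (Set.image_mono (Set.subset_insert i S))
  have h1 := (rowSpan W S).finrank_add_finrank_orthogonal
  have h2 := (rowSpan W (insert i S)).finrank_add_finrank_orthogonal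
  have key : rowCodim W (insert i S) + (if rowVec W i ∉ rowSpan W S then 1 else 0) ≤
      rowCodim W S := by
    unfold rowCodim
    by_cases h : rowVec W i ∉ rowSpan W S
    · rw [if_pos h]
      have hlt : rowSpan W S < rowSpan W (insert i S) := by
        refine lt_of_le_of_ne hle fun heq => h ?_
        rw [heq]
        exact Submodule.subset_span ⟨i, Set.mem_insert i S, rfl⟩
      have := Submodule.finrank_lt_finrank_of_lt hlt
      omega
    · rw [if_neg h]
      have := Submodule.finrank_mono hle
      omega
  have := (Nat.cast_le (α := ℝ)).mpr key
  push_cast at this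
  linarith

-- One draw of the process: the average over the undrawn rows of the new codimension is at most `1 -
-- 1 / ν` times the old one.
open Classical in
theorem sum_rowCodim_insert_le [Fintype α] [DecidableEq κ] {W : Matrix α κ ℝ} (hW : Wᵀ * W = 1) {ν : ℝ}
    (hν : 1 ≤ ν) (hR : ∀ i, ∑ k, W i k ^ 2 ≤ ν / Fintype.card α) (S : Set α) :
    ∑ i : {i // i ∉ S}, (rowCodim W (insert i.1 S) : ℝ) ≤
      Fintype.card {i // i ∉ S} * ((1 - 1 / ν) * rowCodim W S) := by
  set c : ℝ := (rowCodim W S : ℝ) with hcdef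
  set g : α → ℝ := fun i => if rowVec W i ∉ rowSpan W S then 1 else 0
  -- Drawn rows already lie in the span, so every row that enlarges it is still available.
  have hg : ∑ i : {i // i ∉ S}, g i = ∑ i, g i := by
    rw [← Finset.sum_subtype (Finset.univ.filter fun i => i ∉ S) (by simp) g]
    refine Finset.sum_subset (Finset.subset_univ _) fun i _ hi => ?_
    have hiS : i ∈ S := by simpa using hi
    have : rowVec W i ∈ rowSpan W S := Submodule.subset_span ⟨i, hiS, rfl⟩
    simp [g, this]
  have hcard : ∑ i, g i = (Finset.univ.filter fun i => rowVec W i ∉ rowSpan W S).card := by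
    simp only [g, Finset.sum_boole]
  have hfr := finrank_orthogonal_le hW hR (rowSpan W S)
  rw [← hcard] at hfr
  change c ≤ _ at hfr
  have hc : 0 ≤ c := Nat.cast_nonneg _
  have hν0 : 0 < ν := by linarith
  have hM : (Fintype.card {i // i ∉ S} : ℝ) ≤ Fintype.card α := by
    exact_mod_cast Fintype.card_subtype_le _
  set N : ℝ := (Fintype.card α : ℝ)
  set m : ℝ := (Fintype.card {i // i ∉ S} : ℝ)
  have hm : 0 ≤ m := Nat.cast_nonneg _
  have hgn : 0 ≤ ∑ i, g i := by rw [hcard]; exact Nat.cast_nonneg _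
  -- Sampling without replacement only helps: the same useful rows are sought among `m ≤ N`
  -- candidates.
  have hmc : m * (c / ν) ≤ ∑ i, g i := by
    rcases hm.eq_or_lt with h0 | h0
    · rw [← h0, zero_mul]
      exact hgn
    · have hN : 0 < N := h0.trans_le hM
      have h1 : m * (c / ν) ≤ N * (c / ν) := mul_le_mul_of_nonneg_right hM (by positivity)
      refine h1.trans ?_
      have h2 : N * (c / ν) ≤ N * (ν / N * (∑ i, g i) / ν) := by gcongr
      refine h2.trans_eq ?_
      field_simp
  calc ∑ i : {i // i ∉ S}, (rowCodim W (insert i.1 S) : ℝ)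
      ≤ ∑ i : {i // i ∉ S}, (c - g i) :=
        Finset.sum_le_sum fun i _ => rowCodim_insert_le W S i
    _ = m * c - ∑ i, g i := by
        rw [Finset.sum_sub_distrib, hg]
        simp [m]
    _ ≤ m * c - m * (c / ν) := by linarith
    _ = _ := by ring

theorem range_embeddingFinSucc_symm {β : Type*} {d : ℕ}
    (p : (e : Fin d ↪ β) × {i // i ∉ Set.range e}) :
    Set.range ((Equiv.embeddingFinSucc d β).symm p) = insert p.2.1 (Set.range p.1) := by
  rw [Equiv.coe_embeddingFinSucc_symm, Fin.range_cons]

/-- Sampling `d` rows without replacement multiplies the expected codimension of their span by at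
most `(1 - 1 / ν) ^ d`. -/
theorem sum_rowCodim_le [Fintype α] [DecidableEq κ] {W : Matrix α κ ℝ} (hW : Wᵀ * W = 1) {ν : ℝ}
    (hν : 1 ≤ ν) (hR : ∀ i, ∑ k, W i k ^ 2 ≤ ν / Fintype.card α) (d : ℕ)
    [∀ d, Fintype (Fin d ↪ α)] :
    ∑ f : Fin d ↪ α, (rowCodim W (Set.range f) : ℝ) ≤
      Fintype.card κ * (1 - 1 / ν) ^ d * Fintype.card (Fin d ↪ α) := by
  classical
  have hq : 0 ≤ 1 - 1 / ν := by
    have : 1 / ν ≤ 1 := by rw [div_le_one (by linarith)]; exact hν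
    linarith
  induction d with
  | zero =>
    have h (f : Fin 0 ↪ α) : (rowCodim W (Set.range f) : ℝ) ≤ Fintype.card κ := by
      have := Submodule.finrank_le (rowSpan W (Set.range f))ᗮ
      rw [finrank_euclideanSpace] at this
      exact_mod_cast this
    calc _ ≤ ∑ f : Fin 0 ↪ α, (Fintype.card κ : ℝ) := Finset.sum_le_sum fun f _ => h f
      _ = _ := by simp
  | succ d ih =>
    have hcompl (f : Fin d ↪ α) :
        Fintype.card {i // i ∉ Set.range f} = Fintype.card α - d := by
      rw [Fintype.card_subtype_compl, Fintype.card_range f, Fintype.card_fin]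
    have hstep (f : Fin d ↪ α) :
        ∑ i : {i // i ∉ Set.range f}, (rowCodim W (insert i.1 (Set.range f)) : ℝ) ≤
          ((Fintype.card α - d : ℕ) : ℝ) * ((1 - 1 / ν) * rowCodim W (Set.range f)) := by
      rw [← hcompl f]
      convert sum_rowCodim_insert_le hW hν hR (Set.range f)
    -- An injective sequence of length `d + 1` is one of length `d` together with an unused index.
    have hsum : ∑ f : Fin (d + 1) ↪ α, (rowCodim W (Set.range f) : ℝ) =
        ∑ f : Fin d ↪ α, ∑ i : {i // i ∉ Set.range f},
          (rowCodim W (insert i.1 (Set.range f)) : ℝ) := by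
      rw [← (Equiv.embeddingFinSucc d α).symm.sum_comp, Fintype.sum_sigma]
      simp only [range_embeddingFinSucc_symm]
    have hcount : Fintype.card (Fin (d + 1) ↪ α) =
        (Fintype.card α - d) * Fintype.card (Fin d ↪ α) := by
      simp only [Fintype.card_embedding_eq, Fintype.card_fin, Nat.descFactorial_succ]
    rw [hsum, hcount]
    calc _ ≤ ∑ f : Fin d ↪ α,
          ((Fintype.card α - d : ℕ) : ℝ) * ((1 - 1 / ν) * rowCodim W (Set.range f)) :=
          Finset.sum_le_sum fun f _ => hstep f
      _ = ((Fintype.card α - d : ℕ) : ℝ) * (1 - 1 / ν) *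
          ∑ f : Fin d ↪ α, (rowCodim W (Set.range f) : ℝ) := by
          rw [Finset.mul_sum]
          exact Finset.sum_congr rfl fun f _ => by ring
      _ ≤ ((Fintype.card α - d : ℕ) : ℝ) * (1 - 1 / ν) *
          (Fintype.card κ * (1 - 1 / ν) ^ d * Fintype.card (Fin d ↪ α)) := by
          gcongr
      _ = _ := by push_cast; ring

/-- The probability that `d` rows, sampled without replacement, fail to determine a vector. -/
theorem card_not_determines_le [Fintype α] [DecidableEq κ] {W : Matrix α κ ℝ} (hW : Wᵀ * W = 1) {ν : ℝ}
    (hν : 1 ≤ ν) (hR : ∀ i, ∑ k, W i k ^ 2 ≤ ν / Fintype.card α) (d : ℕ) :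
    (Nat.card {f : Fin d ↪ α // ¬ Determines W (Set.range f)} : ℝ) ≤
      Fintype.card κ * Real.exp (-(d / ν)) * Nat.card (Fin d ↪ α) := by
  classical
  rw [Nat.card_eq_fintype_card, Nat.card_eq_fintype_card, Fintype.card_subtype,
    ← Finset.sum_boole]
  have hν0 : 0 < ν := by linarith
  have hexp : (1 - 1 / ν) ^ d ≤ Real.exp (-(d / ν)) := by
    have h0 : 0 ≤ 1 - 1 / ν := by
      have : 1 / ν ≤ 1 := by rw [div_le_one hν0]; exact hν
      linarith
    calc (1 - 1 / ν) ^ d ≤ Real.exp (-(1 / ν)) ^ d := by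
          gcongr
          exact Real.one_sub_le_exp_neg _
      _ = _ := by rw [← Real.exp_nat_mul]; congr 1; ring
  -- Markov's inequality: a failing sample has codimension at least `1`.
  refine (Finset.sum_le_sum fun f _ => ?_).trans
    ((sum_rowCodim_le hW hν hR d).trans (by gcongr))
  by_cases h : ¬ Determines W (Set.range f)
  · rw [if_pos h]
    have : rowCodim W (Set.range f) ≠ 0 := fun h0 => h (determines_of_rowCodim_eq_zero h0)
    exact_mod_cast Nat.one_le_iff_ne_zero.mpr this
  · rw [if_neg h]
    positivity

end RowSampling

/-! ### From ordered samples to sets -/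

/-- Every `d`-subset is the range of exactly `d!` embeddings. -/
theorem card_embedding_range {α : Type*} [Finite α] (d : ℕ) (p : Set α → Prop) :
    Nat.card {f : Fin d ↪ α // p (Set.range f)} =
      d.factorial * Nat.card {S : {S : Finset α // S.card = d} // p (S.1 : Set α)} := by
  classical
  have := Fintype.ofFinite α
  let F : {f : Fin d ↪ α // p (Set.range f)} →
      {S : {S : Finset α // S.card = d} // p (S.1 : Set α)} :=
    fun f => ⟨⟨Finset.univ.map f.1, by simp⟩, by simpa using f.2⟩
  have hfib (S : {S : {S : Finset α // S.card = d} // p (S.1 : Set α)}) :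
      Nat.card {f // F f = S} = d.factorial := by
    have hcard : Fintype.card (Fin d) = Fintype.card S.1.1 := by simp [S.1.2]
    have e : {f // F f = S} ≃ (Fin d ≃ S.1.1) :=
      { toFun := fun f => Equiv.ofBijective
          (fun i => ⟨f.1.1 i, by
            have h : Finset.univ.map f.1.1 = S.1.1 := congrArg (fun S => S.1.1) f.2
            rw [← h]; simp⟩)
          ((Fintype.bijective_iff_injective_and_card _).mpr
            ⟨fun i j hij => f.1.1.injective (congrArg Subtype.val hij), hcard⟩)
        invFun := fun e =>
          ⟨⟨e.toEmbedding.trans (Function.Embedding.subtype _), by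
            have h : Set.range (e.toEmbedding.trans (Function.Embedding.subtype _)) =
                (S.1.1 : Set α) := by
              ext x
              constructor
              · rintro ⟨i, rfl⟩
                exact (e i).2
              · intro hx
                exact ⟨e.symm ⟨x, hx⟩, by simp⟩
            rw [h]; exact S.2⟩, by
            apply Subtype.ext
            apply Subtype.ext
            ext x
            simp only [F, Finset.mem_map, Finset.mem_univ, true_and]
            constructor
            · rintro ⟨i, rfl⟩
              exact (e i).2
            · intro hx
              exact ⟨e.symm ⟨x, hx⟩, by simp⟩⟩
        left_inv := fun f => by ext; rfl
        right_inv := fun e => by ext; rfl }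
    rw [Nat.card_congr e, Nat.card_eq_fintype_card,
      Fintype.card_equiv (Fintype.equivOfCardEq hcard), Fintype.card_fin]
  rw [← Nat.card_congr (Equiv.sigmaFiberEquiv F), Nat.card_sigma]
  simp only [hfib, Finset.sum_const, Finset.card_univ, smul_eq_mul, Nat.card_eq_fintype_card]
  ring

/-- The probability that a uniformly random set of `d` rows fails to determine a vector. -/
theorem card_finset_not_determines_le {α κ : Type*} [Fintype α] [Fintype κ] [DecidableEq κ]
    {W : Matrix α κ ℝ} (hW : Wᵀ * W = 1) {ν : ℝ}
    (hν : 1 ≤ ν) (hR : ∀ i, ∑ k, W i k ^ 2 ≤ ν / Fintype.card α) (d : ℕ) :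
    (Nat.card {S : {S : Finset α // S.card = d} // ¬ Determines W (S.1 : Set α)} : ℝ) ≤
      Fintype.card κ * Real.exp (-(d / ν)) * Nat.card {S : Finset α // S.card = d} := by
  have h := card_not_determines_le hW hν hR d
  rw [card_embedding_range d fun S => ¬ Determines W S] at h
  -- The factor `d!` also appears in the total count, so it cancels from the probability.
  have h2 := card_embedding_range (α := α) d fun _ => True
  rw [Nat.card_congr (Equiv.subtypeUnivEquiv fun _ => trivial),
    Nat.card_congr (Equiv.subtypeUnivEquiv fun _ => trivial)] at h2
  rw [h2] at h
  push_cast at h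
  have hd : (0 : ℝ) < d.factorial := by exact_mod_cast d.factorial_pos
  refine le_of_mul_le_mul_left (h.trans_eq ?_) hd
  ring

open Matrix

/-! ### Column spaces, low rank factorizations and leading eigenvectors -/

section LinearAlgebra

theorem antitone_eq_zero_of_rank_le {k r : ℕ} {ev : Fin k → ℝ} (ha : Antitone ev)
    (h0 : ∀ i, 0 ≤ ev i) (hr : (diagonal ev).rank ≤ r) {i : Fin k} (hi : r ≤ i) : ev i = 0 := by
  classical
  by_contra hne
  have hpos : 0 < ev i := lt_of_le_of_ne (h0 i) (Ne.symm hne)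
  rw [rank_diagonal, Fintype.card_subtype] at hr
  -- A positive entry at `i` makes `i + 1 > r` entries positive, too many for the rank.
  have hsub : Finset.Iic i ⊆ Finset.univ.filter fun j => ev j ≠ 0 := by
    intro j hj
    have : ev i ≤ ev j := ha (Finset.mem_Iic.mp hj)
    simp only [Finset.mem_filter, Finset.mem_univ, true_and]
    exact (hpos.trans_le this).ne'
  have := Finset.card_le_card hsub
  rw [Fin.card_Iic] at this
  omega

theorem rank_le_of_orthonormal {n m k l : ℕ} {U : Matrix (Fin n) (Fin k) ℝ}
    {V : Matrix (Fin m) (Fin l) ℝ} (hU : Uᵀ * U = 1) (hV : Vᵀ * V = 1)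
    (D : Matrix (Fin k) (Fin l) ℝ) : D.rank ≤ (U * D * Vᵀ).rank := by
  have h : D = Uᵀ * (U * D * Vᵀ) * V := by
    calc D = (Uᵀ * U) * D * (Vᵀ * V) := by rw [hU, hV, Matrix.one_mul, Matrix.mul_one]
      _ = _ := by simp only [Matrix.mul_assoc]
  calc D.rank = (Uᵀ * (U * D * Vᵀ) * V).rank := by rw [← h]
    _ ≤ (Uᵀ * (U * D * Vᵀ)).rank := rank_mul_le_left _ _
    _ ≤ _ := rank_mul_le_right _ _

theorem firstCols_transpose_mul_self {k l r : ℕ} (h : r ≤ l) {X : Matrix (Fin k) (Fin l) ℝ}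
    (hX : Xᵀ * X = 1) : (firstCols h X)ᵀ * firstCols h X = 1 := by
  ext i j
  have : ((firstCols h X)ᵀ * firstCols h X) i j = (Xᵀ * X) (Fin.castLE h i) (Fin.castLE h j) := rfl
  rw [this, hX]
  simp [Matrix.one_apply]

/-- Vanishing diagonal entries may be dropped from a factorization. -/
theorem mul_diagonal_mul_transpose_firstCols {n m k r : ℕ} (h : r ≤ k)
    (U : Matrix (Fin n) (Fin k) ℝ) (V : Matrix (Fin m) (Fin k) ℝ) {σ : Fin k → ℝ}
    (hσ : ∀ i : Fin k, r ≤ i → σ i = 0) :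
    U * diagonal σ * Vᵀ =
      firstCols h U * diagonal (fun i => σ (Fin.castLE h i)) * (firstCols h V)ᵀ := by
  ext i j
  simp only [Matrix.mul_apply (M := _ * diagonal _), Matrix.mul_diagonal, transpose_apply]
  refine (Fintype.sum_of_injective (Fin.castLE h) (Fin.castLE_injective h) _ _ ?_ ?_).symm
  · intro a ha
    rw [hσ a, mul_zero, zero_mul]
    by_contra hlt
    exact ha ⟨⟨a, not_le.mp hlt⟩, rfl⟩
  · intro a
    rfl

theorem IsSVD.eq_firstCols {n m r : ℕ} (hrm : r ≤ m) {M U : Matrix (Fin n) (Fin m) ℝ}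
    {σ : Fin m → ℝ} {V : Matrix (Fin m) (Fin m) ℝ} (h : IsSVD M U σ V) (hr : M.rank ≤ r) :
    M = firstCols hrm U * diagonal (fun i => σ (Fin.castLE hrm i)) * (firstCols hrm V)ᵀ := by
  obtain ⟨hU, hV, ha, h0, hM⟩ := h
  rw [← mul_diagonal_mul_transpose_firstCols hrm U V, hM]
  intro i hi
  refine antitone_eq_zero_of_rank_le ha h0 ?_ hi
  exact (rank_le_of_orthonormal hU hV _).trans (hM ▸ hr)

theorem colSpace_mul_le {k l p : ℕ} (X : Matrix (Fin k) (Fin l) ℝ) (Y : Matrix (Fin l) (Fin p) ℝ) :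
    colSpace (X * Y) ≤ colSpace X := by
  unfold colSpace
  rw [mulVecLin_mul]
  exact LinearMap.range_comp_le_range _ _

theorem exists_eq_mul_of_colSpace_le {k l p : ℕ} {X : Matrix (Fin k) (Fin l) ℝ}
    {Y : Matrix (Fin k) (Fin p) ℝ} (h : colSpace Y ≤ colSpace X) :
    ∃ W : Matrix (Fin l) (Fin p) ℝ, Y = X * W := by
  have hj (j : Fin p) : ∃ w : Fin l → ℝ, X *ᵥ w = Y.col j := by
    have : Y.col j ∈ colSpace Y := ⟨Pi.single j 1, by simp⟩
    exact h this
  choose w hw using hj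
  refine ⟨(Matrix.of w)ᵀ, ?_⟩
  ext i j
  have := congrFun (hw j) i
  exact this.symm

theorem colSpace_mul_of_mul_eq_one {k l p : ℕ} (X : Matrix (Fin k) (Fin l) ℝ)
    {Y : Matrix (Fin l) (Fin p) ℝ} {B : Matrix (Fin p) (Fin l) ℝ} (h : Y * B = 1) :
    colSpace (X * Y) = colSpace X := by
  refine le_antisymm (colSpace_mul_le X Y) ?_
  have := colSpace_mul_le (X * Y) B
  rwa [Matrix.mul_assoc, h, Matrix.mul_one] at this

/-- Columns in positions that determine the row space of `M` span its column space. -/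
theorem colSpace_sampledCols {n m r d : ℕ} {M : Matrix (Fin n) (Fin m) ℝ}
    {X : Matrix (Fin n) (Fin r) ℝ} {Y : Matrix (Fin m) (Fin r) ℝ} (hY : Yᵀ * Y = 1)
    (hM : M = X * Yᵀ) {I : Fin d ↪ Fin m} (hI : Determines Y (Set.range I)) :
    colSpace (sampledCols M I) = colSpace M := by
  have hA : sampledCols M I = X * (Y.submatrix I id)ᵀ := by
    rw [hM]
    rfl
  have hker : LinearMap.ker (toLin' (Y.submatrix I id)) = ⊥ := by
    rw [LinearMap.ker_eq_bot']
    intro x hx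
    refine hI x ?_
    rintro _ ⟨i, rfl⟩
    exact congrFun hx i
  obtain ⟨g, hg⟩ := LinearMap.exists_leftInverse_of_injective _ hker
  have hB := congrArg LinearMap.toMatrix' hg
  rw [LinearMap.toMatrix'_comp, LinearMap.toMatrix'_toLin', LinearMap.toMatrix'_id] at hB
  set B := LinearMap.toMatrix' g
  have hB' : (Y.submatrix I id)ᵀ * Bᵀ = 1 := by
    rw [← transpose_mul, hB, transpose_one]
  rw [hA, colSpace_mul_of_mul_eq_one X hB', hM, colSpace_mul_of_mul_eq_one X hY]

theorem eigenvalue_nonneg {k d : ℕ} {A : Matrix (Fin k) (Fin d) ℝ} {Q : Matrix (Fin k) (Fin k) ℝ}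
    {ev : Fin k → ℝ} (hQ : Qᵀ * Q = 1) (h : A * Aᵀ = Q * diagonal ev * Qᵀ) (i : Fin k) :
    0 ≤ ev i := by
  have hd : diagonal ev = (Qᵀ * A) * (Qᵀ * A)ᵀ := by
    calc diagonal ev = (Qᵀ * Q) * diagonal ev * (Qᵀ * Q) := by
          rw [hQ, Matrix.one_mul, Matrix.mul_one]
      _ = Qᵀ * (Q * diagonal ev * Qᵀ) * Q := by simp only [Matrix.mul_assoc]
      _ = _ := by rw [← h, transpose_mul, transpose_transpose]; simp only [Matrix.mul_assoc]
  have := congrFun (congrFun hd i) i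
  rw [diagonal_apply_eq] at this
  rw [this, Matrix.mul_apply]
  exact Finset.sum_nonneg fun j _ => mul_self_nonneg _

theorem colSpace_mul_transpose_self {k d : ℕ} (A : Matrix (Fin k) (Fin d) ℝ) :
    colSpace (A * Aᵀ) = colSpace A :=
  Submodule.eq_of_le_of_finrank_eq (colSpace_mul_le A Aᵀ) (rank_self_mul_transpose A)

/-- The eigenvalues of the positive semidefinite `A * Aᵀ` beyond the first `r` vanish, so the
columns of `A` lie in the span of `E`; the dimensions then force equality. -/
theorem IsFirstEigenvectors.colSpace_eq {k r d : ℕ} {h : r ≤ k} {A : Matrix (Fin k) (Fin d) ℝ}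
    {E : Matrix (Fin k) (Fin r) ℝ} (hE : IsFirstEigenvectors h (A * Aᵀ) E) (hr : A.rank = r) :
    colSpace E = colSpace A := by
  obtain ⟨Q, ev, hQ, ha, hS, rfl⟩ := hE
  have hzero (i : Fin k) (hi : r ≤ i) : ev i = 0 := by
    refine antitone_eq_zero_of_rank_le ha (eigenvalue_nonneg hQ hS) ?_ hi
    rw [← hr, ← rank_self_mul_transpose A, hS]
    exact rank_le_of_orthonormal hQ hQ _
  symm
  apply Submodule.eq_of_le_of_finrank_le
  · rw [← colSpace_mul_transpose_self, hS, mul_diagonal_mul_transpose_firstCols h Q Q hzero,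
      Matrix.mul_assoc]
    exact colSpace_mul_le _ _
  · have h1 : (firstCols h Q).rank ≤ r := by simpa using rank_le_width (firstCols h Q)
    exact h1.trans_eq hr.symm

theorem exists_sorted_diagonalization {r : ℕ} {T : Matrix (Fin r) (Fin r) ℝ} (hT : T.IsHermitian) :
    ∃ (Q : Matrix (Fin r) (Fin r) ℝ) (ev : Fin r → ℝ),
      Qᵀ * Q = 1 ∧ Antitone ev ∧ T = Q * diagonal ev * Qᵀ := by
  set P : Matrix (Fin r) (Fin r) ℝ := (hT.eigenvectorUnitary : Matrix (Fin r) (Fin r) ℝ) with hPdef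
  have hP : Pᵀ * P = 1 := by
    have := Unitary.coe_star_mul_self hT.eigenvectorUnitary
    rwa [star_eq_conjTranspose, conjTranspose_eq_transpose_of_trivial] at this
  have hTP : T = P * diagonal hT.eigenvalues * Pᵀ := by
    have := hT.spectral_theorem
    rw [Unitary.conjStarAlgAut_apply] at this
    rw [star_eq_conjTranspose, conjTranspose_eq_transpose_of_trivial] at this
    exact this
  -- `Tuple.sort` sorts increasingly, hence the sign.
  set τ := Tuple.sort fun i => -hT.eigenvalues i
  have hτ : Monotone ((fun i => -hT.eigenvalues i) ∘ τ) := Tuple.monotone_sort _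
  refine ⟨P.submatrix id τ, fun i => hT.eigenvalues (τ i), ?_, ?_, ?_⟩
  · have : (P.submatrix id τ)ᵀ * P.submatrix id τ = (Pᵀ * P).submatrix τ τ := rfl
    rw [this, hP, submatrix_one_equiv]
  · intro i j hij
    have := hτ hij
    simp only [Function.comp_apply] at this
    linarith
  · conv_lhs => rw [hTP]
    ext i j
    simp only [Matrix.mul_apply (M := _ * diagonal _), Matrix.mul_diagonal, transpose_apply,
      submatrix_apply, id]
    exact (Equiv.sum_comp τ fun a => P i a * hT.eigenvalues a * P j a).symm

theorem orthonormal_toLp_cols {k r : ℕ} {X : Matrix (Fin k) (Fin r) ℝ} (hX : Xᵀ * X = 1) :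
    Orthonormal ℝ fun j => (WithLp.toLp 2 (X.col j) : EuclideanSpace ℝ (Fin k)) := by
  rw [orthonormal_iff_ite]
  intro i j
  have := congrFun (congrFun hX j) i
  rw [Matrix.mul_apply, Matrix.one_apply] at this
  rw [EuclideanSpace.inner_eq_star_dotProduct]
  simp only [dotProduct, star_trivial, col_apply, transpose_apply] at this ⊢
  rw [this]
  simp only [eq_comm]

/-- Orthonormal columns can be completed to an orthogonal matrix. -/
theorem exists_orthogonal_firstCols_eq {k r : ℕ} (h : r ≤ k) {X : Matrix (Fin k) (Fin r) ℝ}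
    (hX : Xᵀ * X = 1) : ∃ Q : Matrix (Fin k) (Fin k) ℝ, Qᵀ * Q = 1 ∧ firstCols h Q = X := by
  let s : Set (Fin k) := {i | (i : ℕ) < r}
  let v : Fin k → EuclideanSpace ℝ (Fin k) := fun i =>
    if hi : (i : ℕ) < r then WithLp.toLp 2 (X.col ⟨i, hi⟩) else 0
  have hv : Orthonormal ℝ (s.domRestrict v) := by
    have h1 := (orthonormal_toLp_cols hX).comp (fun i : s => (⟨i.1, i.2⟩ : Fin r))
      (fun i j hij => Subtype.ext (Fin.ext (by simpa using hij)))
    convert h1 using 1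
    ext1 i
    have hi : ((i : Fin k) : ℕ) < r := i.2
    simp [v, Set.domRestrict, hi]
  obtain ⟨b, hb⟩ := hv.exists_orthonormalBasis_extension_of_card_eq (by simp)
  refine ⟨Matrix.of fun i j => b j i, ?_, ?_⟩
  · ext i j
    have := orthonormal_iff_ite.mp b.orthonormal j i
    rw [EuclideanSpace.inner_eq_star_dotProduct] at this
    rw [Matrix.one_apply, Matrix.mul_apply]
    simp only [dotProduct, star_trivial] at this
    simp only [transpose_apply, of_apply]
    rw [this]
    simp only [eq_comm]
  · ext i j
    have hj : Fin.castLE h j ∈ s := j.2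
    have h1 := hb _ hj
    simp only [firstCols, submatrix_apply, of_apply, id]
    rw [h1]
    simp [v]

/-- If the columns of `A` lie in the span of the orthonormal columns of `X`, then first eigenvectors
of `A Aᵀ` can be chosen in this span. -/
theorem exists_isFirstEigenvectors_mul {k r d : ℕ} (h : r ≤ k) {X : Matrix (Fin k) (Fin r) ℝ}
    (hX : Xᵀ * X = 1) (C : Matrix (Fin r) (Fin d) ℝ) :
    ∃ Q : Matrix (Fin r) (Fin r) ℝ, Qᵀ * Q = 1 ∧
      IsFirstEigenvectors h ((X * C) * (X * C)ᵀ) (X * Q) := by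
  have hT : (C * Cᵀ).IsHermitian := by
    have := isHermitian_mul_conjTranspose_self C
    rwa [conjTranspose_eq_transpose_of_trivial] at this
  obtain ⟨P, ev, hP, ha, hTP⟩ := exists_sorted_diagonalization hT
  have h0 := eigenvalue_nonneg hP hTP
  have hXP : (X * P)ᵀ * (X * P) = 1 := by
    calc (X * P)ᵀ * (X * P) = Pᵀ * (Xᵀ * X) * P := by
          rw [transpose_mul]; simp only [Matrix.mul_assoc]
      _ = 1 := by rw [hX, Matrix.mul_one, hP]
  obtain ⟨Q, hQ, hQX⟩ := exists_orthogonal_firstCols_eq h hXP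
  -- Padding by zeros keeps the order descending because `ev` is nonnegative.
  let ev' : Fin k → ℝ := fun i => if hi : (i : ℕ) < r then ev ⟨i, hi⟩ else 0
  refine ⟨P, hP, Q, ev', hQ, ?_, ?_, hQX.symm⟩
  · intro i j hij
    by_cases hj : (j : ℕ) < r
    · have hi : (i : ℕ) < r := lt_of_le_of_lt hij hj
      simp only [ev', dif_pos hi, dif_pos hj]
      exact ha hij
    · simp only [ev', dif_neg hj]
      split_ifs
      · exact h0 _
      · exact le_rfl
  · rw [mul_diagonal_mul_transpose_firstCols h Q Q (σ := ev')
      (fun i hi => by simp [ev', not_lt.mpr hi]), hQX]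
    have : (fun i => ev' (Fin.castLE h i)) = ev := by
      ext i
      simp [ev']
    rw [this]
    calc (X * C) * (X * C)ᵀ = X * (C * Cᵀ) * Xᵀ := by
          rw [transpose_mul]; simp only [Matrix.mul_assoc]
      _ = _ := by rw [hTP, transpose_mul]; simp only [Matrix.mul_assoc]

end LinearAlgebra

/-! ### Deterministic recovery from informative samples -/

section Recovery

variable {n m r d : ℕ}

open scoped Kronecker

/-- Turns observed entries into inner products with rows of one frame, so that entry sampling
becomes row sampling. -/
theorem kronecker_dotProduct (X : Matrix (Fin n) (Fin r) ℝ) (Y : Matrix (Fin m) (Fin r) ℝ)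
    (Z : Matrix (Fin r) (Fin r) ℝ) (i : Fin n) (j : Fin m) :
    (X ⊗ₖ Y) (i, j) ⬝ᵥ (fun p : Fin r × Fin r => Z p.1 p.2) = (X * Z * Yᵀ) i j := by
  simp only [dotProduct, kroneckerMap_apply, Fintype.sum_prod_type, Matrix.mul_apply,
    transpose_apply, Finset.sum_mul]
  rw [Finset.sum_comm]
  exact Finset.sum_congr rfl fun a _ => Finset.sum_congr rfl fun b _ => by ring

theorem objective_nonneg (M : Matrix (Fin n) (Fin m) ℝ) (Uh : Matrix (Fin n) (Fin r) ℝ)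
    (Vh : Matrix (Fin m) (Fin r) ℝ) (Ω : Finset (Fin n × Fin m)) (Z : Matrix (Fin r) (Fin r) ℝ) :
    0 ≤ objective M Uh Vh Ω Z := by
  unfold objective
  positivity

theorem objective_eq_zero_of_eq {M : Matrix (Fin n) (Fin m) ℝ} {Uh : Matrix (Fin n) (Fin r) ℝ}
    {Vh : Matrix (Fin m) (Fin r) ℝ} (Ω : Finset (Fin n × Fin m)) {Z : Matrix (Fin r) (Fin r) ℝ}
    (h : M = Uh * Z * Vhᵀ) : objective M Uh Vh Ω Z = 0 := by
  simp [objective, ← h]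

theorem apply_eq_of_objective_le_zero {M : Matrix (Fin n) (Fin m) ℝ}
    {Uh : Matrix (Fin n) (Fin r) ℝ} {Vh : Matrix (Fin m) (Fin r) ℝ} {Ω : Finset (Fin n × Fin m)}
    {Z : Matrix (Fin r) (Fin r) ℝ} (h : objective M Uh Vh Ω Z ≤ 0) {i : Fin n} {j : Fin m}
    (hij : (i, j) ∈ Ω) : (Uh * Z * Vhᵀ) i j = M i j := by
  have h0 : ∑ i, ∑ j, (restrictTo Ω M - restrictTo Ω (Uh * Z * Vhᵀ)) i j ^ 2 = 0 := by
    refine le_antisymm ?_ (by positivity)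
    unfold objective at h
    linarith
  rw [Finset.sum_eq_zero_iff_of_nonneg fun i _ => by positivity] at h0
  have h1 := h0 i (Finset.mem_univ i)
  rw [Finset.sum_eq_zero_iff_of_nonneg fun i _ => by positivity] at h1
  have h2 := pow_eq_zero_iff (two_ne_zero) |>.mp (h1 j (Finset.mem_univ j))
  simp only [restrictTo, Matrix.sub_apply, of_apply, if_pos hij] at h2
  linarith

variable {hn : r ≤ n} {hm : r ≤ m} {M : Matrix (Fin n) (Fin m) ℝ}
  {X : Matrix (Fin n) (Fin r) ℝ} {Y : Matrix (Fin m) (Fin r) ℝ} {D : Matrix (Fin r) (Fin r) ℝ}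

/-- `M` itself is always a CUR+ estimate. -/
theorem isEstimate_self (hX : Xᵀ * X = 1) (hY : Yᵀ * Y = 1) (hM : M = X * D * Yᵀ)
    (I : Fin d ↪ Fin m) (J : Fin d ↪ Fin n) (Ω : Finset (Fin n × Fin m)) :
    IsEstimate hn hm M X Y I J Ω M := by
  have hA : sampledCols M I = X * (D * (Y.submatrix I id)ᵀ) := by
    rw [hM, Matrix.mul_assoc]
    rfl
  have hB : sampledRows M J = Y * (X.submatrix J id * D)ᵀ := by
    rw [hM, ← transpose_transpose Y, ← transpose_mul, transpose_transpose]
    rfl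
  -- Eigenvectors chosen inside the spans of `X` and `Y` differ from them by orthogonal `P` and `Q`,
  -- so they satisfy the tie convention and represent `M` exactly, whatever the sample.
  obtain ⟨P, hP, hPE⟩ := exists_isFirstEigenvectors_mul hn hX (D * (Y.submatrix I id)ᵀ)
  obtain ⟨Q, hQ, hQE⟩ := exists_isFirstEigenvectors_mul hm hY (X.submatrix J id * D)ᵀ
  have hP' : P * Pᵀ = 1 := mul_eq_one_comm.mp hP
  have hQ' : Q * Qᵀ = 1 := mul_eq_one_comm.mp hQ
  have hZ : M = (X * P) * (Pᵀ * D * Q) * (Y * Q)ᵀ := by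
    calc M = X * (P * Pᵀ) * D * (Q * Qᵀ) * Yᵀ := by
          rw [hP', hQ', Matrix.mul_one, Matrix.mul_one, hM]
      _ = _ := by rw [transpose_mul]; simp only [Matrix.mul_assoc]
  refine ⟨X * P, Y * Q, Pᵀ * D * Q, ?_, ?_, fun _ => ⟨fun _ => ?_, fun _ => ?_⟩, fun Z' => ?_, hZ⟩
  · rw [hA]; exact hPE
  · rw [hB]; exact hQE
  · exact colSpace_mul_of_mul_eq_one X hP'
  · exact colSpace_mul_of_mul_eq_one Y hQ'
  · rw [objective_eq_zero_of_eq Ω hZ]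
    exact objective_nonneg _ _ _ _ _

/-- The eigenvectors computed from samples that span the column space of `M` span the column space
of `X`. -/
theorem colSpace_eigenvectors_eq {k l : ℕ} {N : Matrix (Fin k) (Fin l) ℝ} {hk : r ≤ k}
    {X E : Matrix (Fin k) (Fin r) ℝ} {C : Matrix (Fin r) (Fin l) ℝ} (hN : N = X * C)
    (hr : N.rank ≤ r) {I : Fin d ↪ Fin l} (hA : colSpace (sampledCols N I) = colSpace N)
    (hE : IsFirstEigenvectors hk (sampledCols N I * (sampledCols N I)ᵀ) E)
    (htie : N.rank < r → colSpace (sampledCols N I) = colSpace N → colSpace E = colSpace X) :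
    colSpace E = colSpace X := by
  rcases hr.lt_or_eq with hlt | heq
  · exact htie hlt hA
  · have hrank : (sampledCols N I).rank = r := by
      rw [← heq]
      exact congrArg (fun K : Submodule ℝ (Fin k → ℝ) => Module.finrank ℝ K) hA
    rw [hE.colSpace_eq hrank, hA]
    apply Submodule.eq_of_le_of_finrank_le
    · rw [hN]
      exact colSpace_mul_le X C
    · have h1 : X.rank ≤ r := by simpa using rank_le_width X
      exact h1.trans_eq heq.symm

/-- If the sampled columns, rows and entries are informative, then `M` is the only estimate. -/
theorem setOf_isEstimate_eq_singleton (hX : Xᵀ * X = 1) (hY : Yᵀ * Y = 1)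
    (hM : M = X * D * Yᵀ) (hr : M.rank ≤ r) {I : Fin d ↪ Fin m} {J : Fin d ↪ Fin n}
    {Ω : Finset (Fin n × Fin m)} (hI : Determines Y (Set.range I))
    (hJ : Determines X (Set.range J)) (hΩ : Determines (X ⊗ₖ Y) (Ω : Set (Fin n × Fin m))) :
    {E | IsEstimate hn hm M X Y I J Ω E} = {M} := by
  ext E
  simp only [Set.mem_ofPred_eq, Set.mem_singleton_iff]
  constructor
  swap
  · rintro rfl
    exact isEstimate_self hX hY hM I J Ω
  rintro ⟨Uh, Vh, Z, hUh, hVh, htie, hmin, rfl⟩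
  have hMt : Mᵀ = Y * (X * D)ᵀ := by rw [hM, transpose_mul, transpose_transpose]
  have hMa : M = X * (D * Yᵀ) := by rw [hM, Matrix.mul_assoc]
  have hMt' : Mᵀ = (Y * Dᵀ) * Xᵀ := by rw [hMt, transpose_mul, Matrix.mul_assoc]
  have hrt : Mᵀ.rank ≤ r := by rwa [rank_transpose]
  have hA := colSpace_sampledCols hY hM hI
  have hB := colSpace_sampledCols hX hMt' hJ
  have hU := colSpace_eigenvectors_eq hMa hr hA hUh fun h => (htie h).1
  have hV := colSpace_eigenvectors_eq hMt hrt hB hVh fun h => (htie (by rwa [rank_transpose] at h)).2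
  obtain ⟨P, hP⟩ := exists_eq_mul_of_colSpace_le hU.le
  obtain ⟨P', hP'⟩ := exists_eq_mul_of_colSpace_le hU.ge
  obtain ⟨Q, hQ⟩ := exists_eq_mul_of_colSpace_le hV.le
  obtain ⟨Q', hQ'⟩ := exists_eq_mul_of_colSpace_le hV.ge
  -- A competitor with objective zero, so every minimizer must fit all observed entries.
  have hopt : M = Uh * (P' * D * Q'ᵀ) * Vhᵀ := by
    calc M = (Uh * P') * D * (Vh * Q')ᵀ := by rw [← hP', ← hQ', hM]
      _ = _ := by rw [transpose_mul]; simp only [Matrix.mul_assoc]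
  have hle : objective M Uh Vh Ω Z ≤ 0 :=
    (hmin _).trans_eq (objective_eq_zero_of_eq Ω hopt)
  have hEX : Uh * Z * Vhᵀ = X * (P * Z * Qᵀ) * Yᵀ := by
    rw [hP, hQ, transpose_mul]; simp only [Matrix.mul_assoc]
  have hzero := hΩ (fun p => (P * Z * Qᵀ - D) p.1 p.2) (by
    rintro ⟨i, j⟩ hij
    rw [kronecker_dotProduct, Matrix.mul_sub, Matrix.sub_mul, ← hEX, ← hM, Matrix.sub_apply,
      apply_eq_of_objective_le_zero hle hij, sub_self])
  have hD : P * Z * Qᵀ = D := by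
    ext a b
    have := congrFun hzero (a, b)
    simpa [sub_eq_zero] using this
  rw [hEX, hD, hM]

end Recovery

open scoped Kronecker

/-! ### Union bound and exponential estimate -/

section Probability

/-- The union bound for three independent uniformly distributed random variables. -/
theorem one_sub_le_card_div_card {A B C : Type*} [Finite A] [Finite B] [Finite C]
    [Nonempty A] [Nonempty B] [Nonempty C] {P : A → Prop} {Q : B → Prop} {R : C → Prop}
    {G : A × B × C → Prop} (hG : ∀ a b c, P a → Q b → R c → G (a, b, c)) {p q u : ℝ}
    (hP : (Nat.card {a // ¬ P a} : ℝ) ≤ p * Nat.card A)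
    (hQ : (Nat.card {b // ¬ Q b} : ℝ) ≤ q * Nat.card B)
    (hR : (Nat.card {c // ¬ R c} : ℝ) ≤ u * Nat.card C) :
    1 - (p + q + u) ≤ (Nat.card {ω // G ω} : ℝ) / (Nat.card (A × B × C) : ℝ) := by
  classical
  have := Fintype.ofFinite A
  have := Fintype.ofFinite B
  have := Fintype.ofFinite C
  simp only [Nat.card_eq_fintype_card, Fintype.card_subtype] at *
  rw [← Finset.sum_boole] at hP hQ hR ⊢
  have hA : (0 : ℝ) < Fintype.card A := by exact_mod_cast Fintype.card_pos
  have hB : (0 : ℝ) < Fintype.card B := by exact_mod_cast Fintype.card_pos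
  have hC : (0 : ℝ) < Fintype.card C := by exact_mod_cast Fintype.card_pos
  have hcard : (Fintype.card (A × B × C) : ℝ) =
      Fintype.card A * Fintype.card B * Fintype.card C := by
    rw [Fintype.card_prod, Fintype.card_prod]
    push_cast
    ring
  rw [hcard, le_div_iff₀ (by positivity)]
  have hle : ∑ ω : A × B × C, (1 - ((if ¬ P ω.1 then (1 : ℝ) else 0) +
      (if ¬ Q ω.2.1 then (1 : ℝ) else 0) + (if ¬ R ω.2.2 then (1 : ℝ) else 0))) ≤
      ∑ ω : A × B × C, if G ω then (1 : ℝ) else 0 := by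
    refine Finset.sum_le_sum fun ω _ => ?_
    have := hG ω.1 ω.2.1 ω.2.2
    by_cases h1 : P ω.1 <;> by_cases h2 : Q ω.2.1 <;> by_cases h3 : R ω.2.2 <;>
      by_cases h4 : G ω <;> simp [h1, h2, h3, h4] at this ⊢ <;> norm_num
  refine le_trans ?_ hle
  have s1 (f : A → ℝ) : ∑ ω : A × B × C, f ω.1 =
      (∑ a, f a) * (Fintype.card B * Fintype.card C) := by
    rw [Fintype.sum_prod_type, Finset.sum_mul]
    simp [mul_comm]
  have s2 (f : B → ℝ) : ∑ ω : A × B × C, f ω.2.1 =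
      (∑ b, f b) * (Fintype.card A * Fintype.card C) := by
    simp only [Fintype.sum_prod_type, Finset.sum_const, Finset.card_univ, nsmul_eq_mul,
      ← Finset.mul_sum]
    ring
  have s3 (f : C → ℝ) : ∑ ω : A × B × C, f ω.2.2 =
      (∑ c, f c) * (Fintype.card A * Fintype.card B) := by
    simp only [Fintype.sum_prod_type, Finset.sum_const, Finset.card_univ, nsmul_eq_mul]
    ring
  rw [Finset.sum_sub_distrib, Finset.sum_add_distrib, Finset.sum_add_distrib,
    s1 fun a => if ¬ P a then 1 else 0, s2 fun b => if ¬ Q b then 1 else 0,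
    s3 fun c => if ¬ R c then 1 else 0, Finset.sum_const, Finset.card_univ, nsmul_eq_mul, mul_one,
    hcard]
  have e1 := mul_le_mul_of_nonneg_right hP (mul_pos hB hC).le
  have e2 := mul_le_mul_of_nonneg_right hQ (mul_pos hA hC).le
  have e3 := mul_le_mul_of_nonneg_right hR (mul_pos hA hB).le
  linarith

/-- The factor `7` is slack: `t + log κ ≤ x / ν` is all that is needed. -/
theorem mul_exp_neg_div_le {κ ν t x : ℝ} (hκ : 1 ≤ κ) (hν : 0 < ν) (ht : 0 ≤ t)
    (h : 7 * ν * (t + Real.log κ) ≤ x) : κ * Real.exp (-(x / ν)) ≤ Real.exp (-t) := by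
  have hlog := Real.log_nonneg hκ
  have hx : t + Real.log κ ≤ x / ν := by
    rw [le_div_iff₀ hν]
    nlinarith [mul_nonneg hν.le (add_nonneg ht hlog)]
  calc κ * Real.exp (-(x / ν)) = Real.exp (Real.log κ + -(x / ν)) := by
        rw [Real.exp_add, Real.exp_log (by linarith)]
    _ ≤ Real.exp (-t) := Real.exp_le_exp.mpr (by linarith)

end Probability

/-! ### Row norms and incoherence -/

section Incoherence

variable {n m r : ℕ} {X : Matrix (Fin n) (Fin r) ℝ} {Y : Matrix (Fin m) (Fin r) ℝ}

theorem sum_row_sq_le_of_iSup {k : ℕ} (hr : 0 < r) {X : Matrix (Fin k) (Fin r) ℝ} {μ : ℝ}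
    (h : ⨆ i : Fin k, (k : ℝ) / (r : ℝ) * ∑ a, X i a ^ 2 ≤ μ) (i : Fin k) :
    ∑ a, X i a ^ 2 ≤ μ * r / k := by
  have h1 := (le_ciSup (Set.finite_range
    fun i : Fin k => (k : ℝ) / (r : ℝ) * ∑ a, X i a ^ 2).bddAbove i).trans h
  have hk : (0 : ℝ) < k := by exact_mod_cast i.pos
  have hr' : (0 : ℝ) < r := by exact_mod_cast hr
  rw [le_div_iff₀ hk]
  rw [div_mul_eq_mul_div, div_le_iff₀ hr'] at h1
  linarith

theorem sum_row_sq_le_left (hr : 0 < r) (i : Fin n) :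
    ∑ a, X i a ^ 2 ≤ incoherence X Y * r / n :=
  sum_row_sq_le_of_iSup hr (le_max_left _ _) i

theorem sum_row_sq_le_right (hr : 0 < r) (i : Fin m) :
    ∑ a, Y i a ^ 2 ≤ incoherence X Y * r / m :=
  sum_row_sq_le_of_iSup hr (le_max_right _ _) i

/-- The squared row norms of `X` sum to the trace `r`, so their rescaled maximum is at least their
average `1`. -/
theorem one_le_incoherence (hr : 0 < r) (hX : Xᵀ * X = 1) : 1 ≤ incoherence X Y := by
  have hr' : (0 : ℝ) < r := by exact_mod_cast hr
  have hsum : ∑ i, ∑ a, X i a ^ 2 = (r : ℝ) := by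
    have h := congrArg Matrix.trace hX
    rw [trace_one, Fintype.card_fin, Matrix.trace] at h
    rw [Finset.sum_comm, ← h]
    exact Finset.sum_congr rfl fun a _ => by
      rw [diag_apply, Matrix.mul_apply]
      exact Finset.sum_congr rfl fun i _ => by rw [transpose_apply, sq]
  have hle : ∑ i, ∑ a, X i a ^ 2 ≤ ∑ _i : Fin n, incoherence X Y * r / n :=
    Finset.sum_le_sum fun i _ => sum_row_sq_le_left hr i
  rw [hsum, Finset.sum_const, Finset.card_univ, Fintype.card_fin, nsmul_eq_mul] at hle
  rcases Nat.eq_zero_or_pos n with rfl | hn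
  · simp at hle
    linarith
  · have hn' : (n : ℝ) ≠ 0 := by exact_mod_cast hn.ne'
    rw [mul_div_cancel₀ _ hn'] at hle
    nlinarith

theorem kronecker_transpose_mul_self (hX : Xᵀ * X = 1) (hY : Yᵀ * Y = 1) :
    (X ⊗ₖ Y)ᵀ * (X ⊗ₖ Y) = 1 := by
  rw [← kroneckerMap_transpose, ← mul_kronecker_mul, hX, hY, one_kronecker_one]

theorem sum_kronecker_row_sq (p : Fin n × Fin m) :
    ∑ k, (X ⊗ₖ Y) p k ^ 2 = (∑ a, X p.1 a ^ 2) * ∑ b, Y p.2 b ^ 2 := by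
  rw [Fintype.sum_prod_type, Finset.sum_mul_sum]
  exact Finset.sum_congr rfl fun a _ => Finset.sum_congr rfl fun b _ => by
    rw [kroneckerMap_apply, mul_pow]

end Incoherence

/-! ### Failure probabilities and sample sizes -/

section Main

theorem card_not_determines_le_exp {k d r : ℕ} (hr : 1 ≤ r) {W : Matrix (Fin k) (Fin r) ℝ}
    (hW : Wᵀ * W = 1) {μ t : ℝ} (hμ : 1 ≤ μ) (hR : ∀ i, ∑ a, W i a ^ 2 ≤ μ * r / k) (ht : 0 ≤ t)
    (hd : 7 * μ * r * (t + Real.log r) ≤ d ∨ d = k) :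
    (Nat.card {f : Fin d ↪ Fin k // ¬ Determines W (Set.range f)} : ℝ) ≤
      Real.exp (-t) * Nat.card (Fin d ↪ Fin k) := by
  have hr' : (1 : ℝ) ≤ r := by exact_mod_cast hr
  have hν : 1 ≤ μ * r := one_le_mul_of_one_le_of_one_le hμ hr'
  rcases hd with hd | rfl
  · refine (card_not_determines_le hW hν (by simpa using hR) d).trans ?_
    refine mul_le_mul_of_nonneg_right ?_ (Nat.cast_nonneg _)
    rw [Fintype.card_fin]
    exact mul_exp_neg_div_le hr' (by linarith) ht (by linarith)
  · have hempty : IsEmpty {f : Fin d ↪ Fin d // ¬ Determines W (Set.range f)} := by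
      refine ⟨fun f => f.2 ?_⟩
      rw [(Finite.surjective_of_injective f.1.injective).range_eq]
      exact determines_univ hW
    rw [Nat.card_of_isEmpty, Nat.cast_zero]
    positivity

theorem card_finset_not_determines_le_exp {n m r s : ℕ} (hr : 1 ≤ r)
    {X : Matrix (Fin n) (Fin r) ℝ} {Y : Matrix (Fin m) (Fin r) ℝ} (hX : Xᵀ * X = 1)
    (hY : Yᵀ * Y = 1) {μ t : ℝ} (hμ : 1 ≤ μ) (hRX : ∀ i, ∑ a, X i a ^ 2 ≤ μ * r / n)
    (hRY : ∀ i, ∑ a, Y i a ^ 2 ≤ μ * r / m) (ht : 0 ≤ t)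
    (hs : 7 * μ ^ 2 * r ^ 2 * (t + 2 * Real.log r) ≤ s ∨ s = n * m) :
    (Nat.card {Ω : {Ω : Finset (Fin n × Fin m) // Ω.card = s} //
        ¬ Determines (X ⊗ₖ Y) (Ω.1 : Set (Fin n × Fin m))} : ℝ) ≤
      Real.exp (-t) * Nat.card {Ω : Finset (Fin n × Fin m) // Ω.card = s} := by
  have hr' : (1 : ℝ) ≤ r := by exact_mod_cast hr
  have hν : 1 ≤ μ ^ 2 * (r : ℝ) ^ 2 :=
    one_le_mul_of_one_le_of_one_le (one_le_pow₀ hμ) (one_le_pow₀ hr')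
  have hW := kronecker_transpose_mul_self hX hY
  rcases hs with hs | rfl
  · have hR (p : Fin n × Fin m) : ∑ k, (X ⊗ₖ Y) p k ^ 2 ≤
        μ ^ 2 * (r : ℝ) ^ 2 / Fintype.card (Fin n × Fin m) := by
      rw [sum_kronecker_row_sq]
      refine (mul_le_mul (hRX p.1) (hRY p.2) (by positivity) (by positivity)).trans_eq ?_
      rw [Fintype.card_prod, Fintype.card_fin, Fintype.card_fin]
      push_cast
      rw [div_mul_div_comm]
      ring
    refine (card_finset_not_determines_le hW hν hR s).trans ?_
    refine mul_le_mul_of_nonneg_right ?_ (Nat.cast_nonneg _)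
    rw [Fintype.card_prod, Fintype.card_fin]
    push_cast
    refine mul_exp_neg_div_le (one_le_mul_of_one_le_of_one_le hr' hr') (by linarith) ht ?_
    rw [Real.log_mul (by linarith) (by linarith)]
    linarith
  · have hempty : IsEmpty {Ω : {Ω : Finset (Fin n × Fin m) // Ω.card = n * m} //
        ¬ Determines (X ⊗ₖ Y) (Ω.1 : Set (Fin n × Fin m))} := by
      refine ⟨fun Ω => Ω.2 ?_⟩
      have : Ω.1.1 = Finset.univ := by
        rw [← Finset.card_eq_iff_eq_univ, Ω.1.2]
        simp
      rw [this, Finset.coe_univ]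
      exact determines_univ hW
    rw [Nat.card_of_isEmpty, Nat.cast_zero]
    positivity

/-- Exact recovery with high probability, when each of the samples is either large compared to the
incoherence or exhaustive. -/
theorem one_sub_le_recoveryProb {n m r d s : ℕ} (hmn : m ≤ n) (hr : 1 ≤ r) (hrm : r ≤ m)
    (hdm : d ≤ m) (hs : s ≤ n * m) {M U : Matrix (Fin n) (Fin m) ℝ} {σ : Fin m → ℝ}
    {V : Matrix (Fin m) (Fin m) ℝ} {t : ℝ} (hSVD : IsSVD M U σ V) (hrank : M.rank ≤ r)
    (hd : 7 * incoherence (firstCols hrm U) (firstCols hrm V) * r * (t + Real.log r) ≤ d ∨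
      (d = n ∧ d = m))
    (hs' : 7 * incoherence (firstCols hrm U) (firstCols hrm V) ^ 2 * r ^ 2 *
      (t + 2 * Real.log r) ≤ s ∨ s = n * m) :
    1 - 5 * Real.exp (-t) ≤
      recoveryProb (hrm.trans hmn) hrm d s M (firstCols hrm U) (firstCols hrm V) := by
  -- For negative `t` the claimed lower bound is negative.
  rcases lt_or_ge t 0 with ht | ht
  · have h1 : 1 ≤ Real.exp (-t) := Real.one_le_exp (by linarith)
    have h2 : 0 ≤ recoveryProb (hrm.trans hmn) hrm d s M (firstCols hrm U) (firstCols hrm V) := by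
      unfold recoveryProb
      positivity
    linarith
  have hM := hSVD.eq_firstCols hrm hrank
  have hX := firstCols_transpose_mul_self hrm hSVD.1
  have hY := firstCols_transpose_mul_self hrm hSVD.2.1
  set X := firstCols hrm U
  set Y := firstCols hrm V
  have hμ : 1 ≤ incoherence X Y := one_le_incoherence hr hX
  have hRX (i) := sum_row_sq_le_left (X := X) (Y := Y) hr i
  have hRY (i) := sum_row_sq_le_right (X := X) (Y := Y) hr i
  have : Nonempty (Fin d ↪ Fin m) := ⟨Fin.castLEEmb hdm⟩
  have : Nonempty (Fin d ↪ Fin n) := ⟨Fin.castLEEmb (hdm.trans hmn)⟩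
  have : Nonempty {Ω : Finset (Fin n × Fin m) // Ω.card = s} := by
    obtain ⟨Ω, -, hΩ⟩ := Finset.exists_subset_card_eq
      (s := (Finset.univ : Finset (Fin n × Fin m))) (n := s) (by simpa using hs)
    exact ⟨⟨Ω, hΩ⟩⟩
  have key := one_sub_le_card_div_card
    (G := fun ω : Sample n m d s =>
      {E | IsEstimate (hrm.trans hmn) hrm M X Y ω.1 ω.2.1 ω.2.2.1 E} = {M})
    (fun I J Ω hI hJ hΩ => setOf_isEstimate_eq_singleton hX hY hM hrank hI hJ hΩ)
    (card_not_determines_le_exp hr hY hμ hRY ht (hd.imp_right And.right))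
    (card_not_determines_le_exp hr hX hμ hRX ht (hd.imp_right And.left))
    (card_finset_not_determines_le_exp hr hX hY hμ hRX hRY ht hs')
  have hexp := Real.exp_pos (-t)
  unfold recoveryProb
  linarith

/-- Sample sizes of order `n r log r` that suffice for incoherence at most `μ₀`. -/
theorem exists_sample_sizes {c μ₀ : ℝ} (hc : 0 < c) : ∃ C : ℝ, 0 < C ∧
    ∀ n r : ℕ, 2 ≤ r → r ≤ n → ∃ d s : ℕ, d ≤ n ∧ s ≤ n * n ∧
      ((2 * d * n + s : ℕ) : ℝ) ≤ C * (n * r * Real.log r) ∧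
      ∀ μ : ℝ, 0 ≤ μ → μ ≤ μ₀ →
        (7 * μ * r * (c * Real.log r + Real.log r) ≤ d ∨ d = n) ∧
        (7 * μ ^ 2 * r ^ 2 * (c * Real.log r + 2 * Real.log r) ≤ s ∨ s = n * n) := by
  -- Keeps the constants positive even if `μ₀` is not.
  set ρ := max μ₀ 1
  have hρ : 0 < ρ := lt_of_lt_of_le one_pos (le_max_right _ _)
  set a := 7 * ρ * (c + 1) with ha
  set b := 7 * ρ ^ 2 * (c + 2) with hb
  have ha0 : 0 < a := by positivity
  have hb0 : 0 < b := by positivity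
  -- The summand `3` absorbs the rounding error `2 * n + 1 ≤ 3 * n`, as `r * log r ≥ 1`.
  refine ⟨2 * a + b + 3, by positivity, fun n r hr hrn => ?_⟩
  have hr2 : (2 : ℝ) ≤ r := by exact_mod_cast hr
  have hrn' : (r : ℝ) ≤ n := by exact_mod_cast hrn
  set L := Real.log r
  have hL : 1 / 2 ≤ L := by
    have h1 := Real.log_two_gt_d9
    have h2 := Real.log_le_log two_pos hr2
    linarith
  have hrL : 1 ≤ r * L := by nlinarith
  -- When the required size exceeds what exists, the cap makes the sample exhaustive.
  refine ⟨min n ⌈a * (r * L)⌉₊, min (n * n) ⌈b * (r ^ 2 * L)⌉₊, min_le_left _ _, min_le_left _ _,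
    ?_, fun μ hμ0 hμ => ⟨?_, ?_⟩⟩
  · have hd : ((min n ⌈a * (r * L)⌉₊ : ℕ) : ℝ) ≤ a * (r * L) + 1 :=
      (Nat.cast_le.mpr (min_le_right _ _)).trans (Nat.ceil_lt_add_one (by positivity)).le
    have hs : ((min (n * n) ⌈b * (r ^ 2 * L)⌉₊ : ℕ) : ℝ) ≤ b * (r ^ 2 * L) + 1 :=
      (Nat.cast_le.mpr (min_le_right _ _)).trans (Nat.ceil_lt_add_one (by positivity)).le
    have hsq : b * (r ^ 2 * L) ≤ b * (n * (r * L)) := by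
      have : (r : ℝ) * (r * L) ≤ n * (r * L) := mul_le_mul_of_nonneg_right hrn' (by linarith)
      refine mul_le_mul_of_nonneg_left ?_ hb0.le
      linarith
    have hn1 : (1 : ℝ) ≤ n := by linarith
    have hnn : (n : ℝ) ≤ n * (r * L) := le_mul_of_one_le_right (by linarith) hrL
    have hdn := mul_le_mul_of_nonneg_right hd (by linarith : (0 : ℝ) ≤ n)
    rw [Nat.cast_add, Nat.cast_mul, Nat.cast_mul, Nat.cast_two]
    nlinarith
  · rcases le_total n ⌈a * (r * L)⌉₊ with h | h
    · exact Or.inr (min_eq_left h)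
    · left
      rw [min_eq_right h]
      refine le_trans ?_ (Nat.le_ceil _)
      have hμρ : μ ≤ ρ := hμ.trans (le_max_left _ _)
      calc 7 * μ * r * (c * L + L) = μ * (7 * (c + 1) * (r * L)) := by ring
        _ ≤ ρ * (7 * (c + 1) * (r * L)) := by gcongr
        _ = a * (r * L) := by ring
  · rcases le_total (n * n) ⌈b * (r ^ 2 * L)⌉₊ with h | h
    · exact Or.inr (min_eq_left h)
    · left
      rw [min_eq_right h]
      refine le_trans ?_ (Nat.le_ceil _)
      have hμρ : μ ≤ ρ := hμ.trans (le_max_left _ _)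
      calc 7 * μ ^ 2 * r ^ 2 * (c * L + 2 * L) = μ ^ 2 * (7 * (c + 2) * (r ^ 2 * L)) := by ring
        _ ≤ ρ ^ 2 * (7 * (c + 2) * (r ^ 2 * L)) := by gcongr
        _ = b * (r ^ 2 * L) := by ring

end Main

end CURPlus

theorem theorem1 :
    -- exact recovery with probability at least `1 - 5 exp (-t)`
    (∀ (n m r d s : ℕ) (hmn : m ≤ n) (_hr : 1 ≤ r) (hrm : r ≤ m) (_hdm : d ≤ m) (_hs : s ≤ n * m)
      (M U : Matrix (Fin n) (Fin m) ℝ) (σ : Fin m → ℝ) (V : Matrix (Fin m) (Fin m) ℝ) (t : ℝ),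
      CURPlus.IsSVD M U σ V →
      M.rank ≤ r →
      7 * CURPlus.incoherence (CURPlus.firstCols hrm U) (CURPlus.firstCols hrm V) * r *
        (t + Real.log r) ≤ d →
      7 * CURPlus.incoherence (CURPlus.firstCols hrm U) (CURPlus.firstCols hrm V) ^ 2 * r ^ 2 *
        (t + 2 * Real.log r) ≤ s →
      1 - 5 * Real.exp (-t) ≤
        CURPlus.recoveryProb (hrm.trans hmn) hrm d s M
          (CURPlus.firstCols hrm U) (CURPlus.firstCols hrm V)) ∧
    -- `t = c log r`: recovery of square matrices of rank `r` and incoherence at most `μ₀` from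
    -- `2 d n + s = O(n r log r)` observed entries
    (∀ c μ₀ : ℝ, 0 < c → ∃ C : ℝ, 0 < C ∧
      ∀ (n r : ℕ) (_hr : 2 ≤ r) (hrn : r ≤ n), ∃ d s : ℕ, d ≤ n ∧ s ≤ n * n ∧
        ((2 * d * n + s : ℕ) : ℝ) ≤ C * (n * r * Real.log r) ∧
        ∀ (M U : Matrix (Fin n) (Fin n) ℝ) (σ : Fin n → ℝ) (V : Matrix (Fin n) (Fin n) ℝ),
          CURPlus.IsSVD M U σ V →
          M.rank = r →
          CURPlus.incoherence (CURPlus.firstCols hrn U) (CURPlus.firstCols hrn V) ≤ μ₀ →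
          1 - 5 * Real.exp (-(c * Real.log r)) ≤
            CURPlus.recoveryProb hrn hrn d s M
              (CURPlus.firstCols hrn U) (CURPlus.firstCols hrn V)) := by
  refine ⟨?_, fun c μ₀ hc => ?_⟩
  · intro n m r d s hmn hr hrm hdm hs M U σ V t hSVD hrank hd hs'
    exact CURPlus.one_sub_le_recoveryProb hmn hr hrm hdm hs hSVD hrank (Or.inl hd) (Or.inl hs')
  · obtain ⟨C, hC, h⟩ := CURPlus.exists_sample_sizes (μ₀ := μ₀) hc
    refine ⟨C, hC, fun n r hr hrn => ?_⟩
    obtain ⟨d, s, hd, hs, hle, h⟩ := h n r hr hrn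
    refine ⟨d, s, hd, hs, hle, fun M U σ V hSVD hrank hμ => ?_⟩
    have hX := CURPlus.firstCols_transpose_mul_self hrn hSVD.1
    have hμ1 := CURPlus.one_le_incoherence (Y := CURPlus.firstCols hrn V) (by omega) hX
    obtain ⟨h1, h2⟩ := h _ (zero_le_one.trans hμ1) hμ
    exact CURPlus.one_sub_le_recoveryProb le_rfl (by omega) hrn hd hs hSVD hrank.le
      (h1.imp_right fun h => ⟨h, h⟩) h2
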